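/- Let $G$ be a nontrivial divisible totally ordered abelian group, and let $K=\mathbb{R}((G))$ be the field of formal power series $\sum_{g\in G} a_g t^g$ with real coefficients and well-ordered support, ordered lexicographically (a nonzero series is positive if and only if its coefficient at the least element of its support is positive). Then $K$ is a real closed field, and $K$ admits a non-surjective logarithm: there is an order-preserving embedding of groups $f\colon (K^{>0},\cdot,1,<)\to (K,+,0,<)$ (that is, $f(xy)=f(x)+f(y)$ for all $x,y>0$, and $x<y$ implies $f(x)<f(y)$) which is not surjective onto $K$. -/

import Mathlib

/-- A (not necessarily surjective) logarithm on an ordered field `K`: an embedding of ordered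
groups of `(K^{>0}, ·, 1, <)` into `(K, +, 0, <)`. -/
def IsLogarithm {K : Type*} [Field K] [LinearOrder K] [IsStrictOrderedRing K]
    (f : {x : K // 0 < x} → K) : Prop :=
  (∀ x y, f (x * y) = f x + f y) ∧ StrictMono f

/-!
Let `K = ℝ((G))`, with valuation `v`.

*Real closedness.* Let `f` be a polynomial over `K`. A ball `{x | γ ≤ v (x - a)}` contains a
number of roots of `f` in an algebraic closure that can be read off from the coefficients of the
Taylor expansion of `f` at `a`; it is the Newton degree (`IsNewtonDegree`). A ball with odd Newton
degree contains a root in `K` (`IsNewtonDegree.exists_isRoot`). Indeed the residue polynomial of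
such a ball is a real polynomial of odd degree, so it has a real root of odd multiplicity, which
leads to a strictly smaller ball with odd Newton degree (`IsNewtonDegree.exists_smaller`);
divisibility of `G` supplies the new radius. Chains of such balls are bounded because `K` is
spherically complete (`exists_pseudoLimit`, `exists_isNewtonDegree_of_chain`), and Zorn's lemma
applies. A polynomial of odd degree has odd Newton degree on a large ball around `0`. For `x > 0`
with leading term `r t^(2k)`, the polynomial `X ^ 2 - x` has Newton degree one on a small ball
around `√r t^k`, so `x` is a square.

*The logarithm.* By the Hahn embedding theorem the ordered group `K^{>0}` embeds into `ℝ((Ω))`,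
where `Ω` is the ordered set of its nontrivial archimedean classes. It is therefore enough to
embed `Ω` into `G` as an ordered set, and to do so non-surjectively. Represent each class by some
`x > 1` and send it to `v (x - 1)`. This is strictly increasing: if `v (y - 1) ≤ v (x - 1)` then
`x - 1 ≤ n (y - 1)` for some `n`, as the coefficients are real, and `x ≤ y ^ n` by Bernoulli's
inequality. For `g < 0`, elements with `v (x - 1) = g` and `v (y - 1) = 2g` are in the same class,
so `g` and `2g` are not both values. A monomial whose exponent is not a value is then outside the
range of the logarithm.
-/

open Polynomial HahnSeries

/-! ### Real polynomials of odd degree -/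

/-- A real polynomial without roots has even degree, since its irreducible factors have
degree two. -/
theorem Real.even_natDegree_of_roots_eq_zero {p : ℝ[X]} (hp : p ≠ 0) (hr : p.roots = 0) :
    Even p.natDegree := by
  induction hn : p.natDegree using Nat.strong_induction_on generalizing p with
  | h n ih =>
    by_cases hu : IsUnit p
    · rw [← hn, natDegree_eq_zero_of_isUnit hu]
      exact Even.zero
    obtain ⟨q, hq, r, rfl⟩ := WfDvdMonoid.exists_irreducible_factor hu hp
    have hr0 : r ≠ 0 := right_ne_zero_of_mul hp
    rw [roots_mul hp, add_eq_zero] at hr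
    rw [natDegree_mul hq.ne_zero hr0] at hn
    have h2 : q.natDegree ≤ 2 := hq.natDegree_le_two
    have h0 : q.natDegree ≠ 0 := hq.natDegree_pos.ne'
    have h1 : q.natDegree ≠ 1 := fun h => by
      obtain ⟨x, hx⟩ := exists_root_of_degree_eq_one (degree_eq_iff_natDegree_eq hq.ne_zero |>.2 h)
      have := (mem_roots hq.ne_zero).2 hx
      simp [hr.1] at this
    have := ih r.natDegree (by omega) hr0 hr.2 rfl
    have h22 : q.natDegree = 2 := by omega
    rw [← hn, h22]
    exact even_two.add this

theorem Real.exists_odd_rootMultiplicity {p : ℝ[X]} (hp : Odd p.natDegree) :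
    ∃ c, Odd (p.rootMultiplicity c) := by
  have hp0 : p ≠ 0 := by rintro rfl; simp at hp
  obtain ⟨q, hq, hd, hq0⟩ := exists_prod_multiset_X_sub_C_mul p
  have hqe := Real.even_natDegree_of_roots_eq_zero
    (by rintro rfl; exact hp0 (hq.symm.trans (mul_zero _))) hq0
  have hodd : Odd (Multiset.card p.roots) := by
    rw [← hd] at hp
    exact (Nat.odd_add.1 hp).2 hqe
  rw [← Multiset.toFinset_sum_count_eq] at hodd
  by_contra! h
  refine Nat.not_even_iff_odd.2 hodd (Finset.even_sum _ fun c _ => ?_)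
  rw [count_roots]
  exact Nat.not_odd_iff_even.1 (h c)

/-! ### Taylor coefficients -/

theorem Polynomial.coeff_taylor_of_lt_rootMultiplicity {R : Type*} [CommRing R] [IsDomain R]
    {p : R[X]} {c : R} {j : ℕ} (hj : j < p.rootMultiplicity c) : (taylor c p).coeff j = 0 := by
  obtain ⟨q, hq⟩ := pow_rootMultiplicity_dvd p c
  rw [hq, taylor_mul, taylor_pow, map_sub, taylor_X, taylor_C, add_sub_cancel_right,
    coeff_X_pow_mul', if_neg (by omega)]

theorem Polynomial.coeff_taylor_rootMultiplicity_ne_zero {R : Type*} [CommRing R] [IsDomain R]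
    {p : R[X]} (hp : p ≠ 0) (c : R) : (taylor c p).coeff (p.rootMultiplicity c) ≠ 0 := by
  obtain ⟨q, hq, hqc⟩ := exists_eq_pow_rootMultiplicity_mul_and_not_dvd p hp c
  rw [dvd_iff_isRoot] at hqc
  conv in (taylor c p) => rw [hq]
  rw [taylor_mul, taylor_pow, map_sub, taylor_X, taylor_C, add_sub_cancel_right,
    coeff_X_pow_mul', if_pos le_rfl, Nat.sub_self, taylor_coeff_zero]
  exact hqc

theorem Polynomial.coeff_taylor_eq_sum_range {R : Type*} [CommRing R] (p : R[X]) (r : R)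
    (j : ℕ) {N : ℕ} (hN : p.natDegree < N) :
    (taylor r p).coeff j = ∑ i ∈ Finset.range N, (i.choose j : R) * p.coeff i * r ^ (i - j) := by
  rw [taylor_coeff, hasseDeriv_apply, sum_over_range' p (by simp) N hN, eval_finsetSum]
  simp

theorem Polynomial.coeff_taylor_X_sq_sub_C {R : Type*} [CommRing R] [Nontrivial R] (a x : R) :
    (taylor a (X ^ 2 - C x)).coeff 0 = a ^ 2 - x ∧ (taylor a (X ^ 2 - C x)).coeff 1 = 2 * a ∧
      (taylor a (X ^ 2 - C x)).coeff 2 = 1 ∧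
      ∀ j, 2 < j → (taylor a (X ^ 2 - C x)).coeff j = 0 := by
  have hd : (X ^ 2 - C x).natDegree = 2 := natDegree_X_pow_sub_C
  refine ⟨by rw [taylor_coeff_zero]; simp, by rw [taylor_coeff_one]; simp [one_add_one_eq_two], ?_,
    fun j hj => ?_⟩
  · conv_lhs => arg 2; rw [← hd]
    rw [coeff_taylor_natDegree]
    exact leadingCoeff_X_pow_sub_C two_pos
  · exact coeff_eq_zero_of_natDegree_lt (by rwa [natDegree_taylor, hd])

namespace HahnSeries

/-! ### Spherical completeness -/

/-- Hahn series are spherically complete: nested balls with centres `a i` and radii `γ i` have a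
common point. Its coefficient at `g` is that of any `a i` with `g < γ i`. -/
theorem exists_pseudoLimit {ι Γ R : Type*} [LinearOrder Γ] [AddGroup R] (a : ι → R⟦Γ⟧) (γ : ι → Γ)
    (h : ∀ i j, γ i ≤ γ j → ↑(γ i) ≤ (a j - a i).orderTop) :
    ∃ b : R⟦Γ⟧, ∀ i, ↑(γ i) ≤ (b - a i).orderTop := by
  classical
  have key : ∀ i j g, g < γ i → g < γ j → (a i).coeff g = (a j).coeff g := by
    intro i j g hi hj
    wlog hij : γ i ≤ γ j generalizing i j
    · exact (this j i hj hi (le_of_not_ge hij)).symm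
    have := coeff_eq_zero_of_lt_orderTop ((WithTop.coe_lt_coe.2 hi).trans_le (h i j hij))
    rw [coeff_sub, sub_eq_zero] at this
    exact this.symm
  let c : Γ → R := fun g => if hg : ∃ i, g < γ i then (a hg.choose).coeff g else 0
  have hc : ∀ i g, g < γ i → c g = (a i).coeff g := fun i g hg => by
    have hex : ∃ i, g < γ i := ⟨i, hg⟩
    simp only [c, dif_pos hex]
    exact key _ _ _ hex.choose_spec hg
  -- an infinite descent in the support stays below one radius `γ i`, so descends in that of `a i`
  have hwf : (Function.support c).IsPWO := by
    rw [Set.isPWO_iff_isWF, Set.IsWF, Set.wellFoundedOn_iff_no_descending_seq]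
    intro f hf
    obtain ⟨i, hi⟩ : ∃ i, f 0 < γ i := by
      by_contra hne
      exact hf 0 (dif_neg hne)
    have hle : ∀ n, f n < γ i := fun n =>
      (show f n ≤ f 0 by
        rcases Nat.eq_zero_or_pos n with rfl | hn
        · exact le_rfl
        · exact (f.map_rel_iff.2 hn).le).trans_lt hi
    refine Set.wellFoundedOn_iff_no_descending_seq.1 (a i).isWF_support f ?_
    intro n
    rw [mem_support, ← hc i _ (hle n)]
    exact hf n
  refine ⟨⟨c, hwf⟩, fun i => le_orderTop_iff_forall.2 fun g hg => ?_⟩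
  rw [coeff_sub, sub_eq_zero]
  exact hc i g (WithTop.coe_lt_coe.1 hg)

variable {G : Type*} [AddCommGroup G] [LinearOrder G] [IsOrderedAddMonoid G]

/-! ### Newton degrees -/

/-- `IsNewtonDegree p γ w m` says that `w` is the minimum over `j` of the weights
`v(p_j) + j • γ`, where `v` is the valuation, and that `m` is the last index at which it is
attained. Then `m` is the number of roots of `p` of valuation at least `γ` in an algebraic closure,
counted with multiplicity. The inequalities are phrased as bounds on `v(p_j)`, which keeps all
arithmetic inside `G`. -/
structure IsNewtonDegree (p : ℝ⟦G⟧[X]) (γ w : G) (m : ℕ) : Prop where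
  orderTop_eq : (p.coeff m).orderTop = ↑(w - m • γ)
  le_orderTop : ∀ j, ↑(w - j • γ) ≤ (p.coeff j).orderTop
  lt_orderTop : ∀ j, m < j → ↑(w - j • γ) < (p.coeff j).orderTop

/-- The Newton degree can only drop when the radius of the ball around `0` shrinks, that is, when
`γ` grows. -/
theorem IsNewtonDegree.le_of_le {p : ℝ⟦G⟧[X]} {γ w γ' w' : G} {m m' : ℕ}
    (h : IsNewtonDegree p γ w m) (h' : IsNewtonDegree p γ' w' m') (hγ : γ ≤ γ') : m' ≤ m := by
  by_contra! hlt
  have h1 := h.lt_orderTop m' hlt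
  have h2 := h'.le_orderTop m
  rw [h'.orderTop_eq, WithTop.coe_lt_coe] at h1
  rw [h.orderTop_eq, WithTop.coe_le_coe] at h2
  obtain ⟨n, rfl⟩ := Nat.exists_eq_add_of_le hlt.le
  have h3 : n • γ ≤ n • γ' := nsmul_le_nsmul_right hγ n
  rw [add_nsmul, add_nsmul] at h1
  have h4 : w + n • γ' < w' - m • γ' + m • γ + n • γ := by
    have := add_lt_add_right h1 (m • γ + n • γ + n • γ')
    convert this using 1 <;> abel
  have h5 : w' - m • γ' + m • γ ≤ w := by
    have := add_le_add_right h2 (m • γ)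
    convert this using 1 <;> abel
  exact absurd h4 (not_lt.2 (add_le_add h5 h3))

/-- A bound for the terms of the Taylor expansion at a point `b` of the ball of radius `γ`. -/
theorem le_orderTop_natCast_mul_mul_pow {x b : ℝ⟦G⟧} {γ g : G} (hb : ↑γ ≤ b.orderTop) (n k : ℕ)
    (hx : ↑g ≤ x.orderTop) : ↑(g + k • γ) ≤ ((n : ℝ⟦G⟧) * x * b ^ k).orderTop := by
  simp only [← addVal_apply] at hx hb ⊢
  rw [AddValuation.map_mul, AddValuation.map_mul, AddValuation.map_pow, WithTop.coe_add,
    WithTop.coe_nsmul]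
  have hn : 0 ≤ addVal G ℝ (n : ℝ⟦G⟧) := by
    rw [addVal_apply, ← single_zero_natCast]; exact orderTop_single_le
  exact add_le_add (hx.trans (le_add_of_nonneg_left hn)) (nsmul_le_nsmul_right hb k)

theorem lt_orderTop_natCast_mul_mul_pow {x b : ℝ⟦G⟧} {γ g : G} (hb : ↑γ ≤ b.orderTop) (n k : ℕ)
    (hx : ↑g < x.orderTop) : ↑(g + k • γ) < ((n : ℝ⟦G⟧) * x * b ^ k).orderTop := by
  by_cases h0 : x = 0
  · rw [h0, mul_zero, zero_mul, orderTop_zero]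
    exact WithTop.coe_lt_top _
  rw [← order_eq_orderTop_of_ne_zero h0, WithTop.coe_lt_coe] at hx
  refine lt_of_lt_of_le ?_ (le_orderTop_natCast_mul_mul_pow hb n k
    (order_eq_orderTop_of_ne_zero h0).le)
  exact WithTop.coe_lt_coe.2 (by gcongr)

/-- The Newton degree does not change when the centre moves inside the ball. -/
theorem IsNewtonDegree.taylor {p : ℝ⟦G⟧[X]} {γ w : G} {m : ℕ} (h : IsNewtonDegree p γ w m)
    {b : ℝ⟦G⟧} (hb : ↑γ ≤ b.orderTop) : IsNewtonDegree (taylor b p) γ w m := by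
  -- the sums are taken up to a bound that leaves room for the index `m`
  have hN : p.natDegree < p.natDegree + m + 1 := by omega
  have hexp : ∀ {i j : ℕ}, j ≤ i → w - i • γ + (i - j) • γ = w - j • γ := by
    intro i j hij
    obtain ⟨d, rfl⟩ := Nat.exists_eq_add_of_le hij
    rw [Nat.add_sub_cancel_left, add_nsmul]; abel
  have hz : ∀ {i j : ℕ}, i < j →
      ((i.choose j : ℝ⟦G⟧) * p.coeff i * b ^ (i - j)).orderTop = ⊤ := by
    intro i j hij
    rw [Nat.choose_eq_zero_of_lt hij, Nat.cast_zero, zero_mul, zero_mul, orderTop_zero]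
  have hle : ∀ i j : ℕ,
      ↑(w - j • γ) ≤ ((i.choose j : ℝ⟦G⟧) * p.coeff i * b ^ (i - j)).orderTop := by
    intro i j
    by_cases hij : j ≤ i
    · rw [← hexp hij]
      exact le_orderTop_natCast_mul_mul_pow hb _ _ (h.le_orderTop i)
    · exact (hz (not_le.1 hij)).symm ▸ le_top
  have hlt : ∀ i j : ℕ, m < i →
      ↑(w - j • γ) < ((i.choose j : ℝ⟦G⟧) * p.coeff i * b ^ (i - j)).orderTop := by
    intro i j hi
    by_cases hij : j ≤ i
    · rw [← hexp hij]
      exact lt_orderTop_natCast_mul_mul_pow hb _ _ (h.lt_orderTop i hi)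
    · exact (hz (not_le.1 hij)).symm ▸ WithTop.coe_lt_top _
  refine ⟨?_, fun j => ?_, fun j hj => ?_⟩
  · rw [coeff_taylor_eq_sum_range p b m hN,
      ← Finset.add_sum_erase _ _ (Finset.mem_range.2 (by omega : m < p.natDegree + m + 1))]
    have hm : ((m.choose m : ℝ⟦G⟧) * p.coeff m * b ^ (m - m)).orderTop = ↑(w - m • γ) := by
      simp [h.orderTop_eq]
    rw [orderTop_add_eq_left, hm]
    rw [hm, ← addVal_apply]
    refine AddValuation.map_lt_sum' _ (WithTop.coe_lt_top _) fun i hi => ?_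
    rw [addVal_apply]
    rcases lt_or_gt_of_ne (Finset.ne_of_mem_erase hi) with him | him
    · exact (hz him).symm ▸ WithTop.coe_lt_top _
    · exact hlt i m him
  · rw [coeff_taylor_eq_sum_range p b j hN, ← addVal_apply]
    exact AddValuation.map_le_sum _ fun i _ => (hle i j).trans_eq addVal_apply.symm
  · rw [coeff_taylor_eq_sum_range p b j hN, ← addVal_apply]
    refine AddValuation.map_lt_sum' _ (WithTop.coe_lt_top _) fun i _ => ?_
    rw [addVal_apply]
    by_cases hij : j ≤ i
    · exact hlt i j (hj.trans_le hij)
    · exact (hz (not_le.1 hij)).symm ▸ WithTop.coe_lt_top _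

/-- The polynomial over `ℝ` formed by the coefficients of `p` at the exponents `w - i • γ`: for
`w` the minimal weight, the residue of `p(t ^ γ • Y) / t ^ w`. -/
noncomputable def residuePoly (p : ℝ⟦G⟧[X]) (γ w : G) : ℝ[X] :=
  ∑ i ∈ Finset.range (p.natDegree + 1), monomial i ((p.coeff i).coeff (w - i • γ))

theorem coeff_residuePoly (p : ℝ⟦G⟧[X]) (γ w : G) (i : ℕ) :
    (residuePoly p γ w).coeff i = (p.coeff i).coeff (w - i • γ) := by
  rw [residuePoly, finsetSum_coeff]
  simp only [coeff_monomial, Finset.sum_ite_eq', Finset.mem_range]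
  split_ifs with h
  · rfl
  · rw [coeff_eq_zero_of_natDegree_lt (by omega), coeff_zero]

theorem natDegree_residuePoly_le (p : ℝ⟦G⟧[X]) (γ w : G) :
    (residuePoly p γ w).natDegree ≤ p.natDegree :=
  natDegree_le_iff_coeff_eq_zero.2 fun i hi => by
    rw [coeff_residuePoly, coeff_eq_zero_of_natDegree_lt hi, coeff_zero]

theorem residuePoly_taylor (p : ℝ⟦G⟧[X]) (γ w : G) (c : ℝ) :
    residuePoly (taylor (single γ c) p) γ w = taylor c (residuePoly p γ w) := by
  ext j
  rw [coeff_residuePoly, coeff_taylor_eq_sum_range p _ j (Nat.lt_succ_self _),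
    coeff_taylor_eq_sum_range _ c j (Nat.lt_succ_of_le (natDegree_residuePoly_le p γ w)),
    coeff_sum]
  refine Finset.sum_congr rfl fun i _ => ?_
  rw [coeff_residuePoly]
  by_cases hij : j ≤ i
  · obtain ⟨d, rfl⟩ := Nat.exists_eq_add_of_le hij
    rw [Nat.add_sub_cancel_left, single_pow, ← single_zero_natCast, mul_assoc,
      coeff_single_zero_mul,
      show w - j • γ = (w - (j + d) • γ) + d • γ by rw [add_nsmul]; abel,
      coeff_mul_single_add, mul_assoc]
  · simp [Nat.choose_eq_zero_of_lt (not_le.1 hij)]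

theorem IsNewtonDegree.natDegree_residuePoly {p : ℝ⟦G⟧[X]} {γ w : G} {m : ℕ}
    (h : IsNewtonDegree p γ w m) : (residuePoly p γ w).natDegree = m := by
  refine natDegree_eq_of_le_of_coeff_ne_zero (natDegree_le_iff_coeff_eq_zero.2 fun i hi => ?_) ?_
  · rw [coeff_residuePoly]
    exact coeff_eq_zero_of_lt_orderTop (h.lt_orderTop i hi)
  · rw [coeff_residuePoly]
    exact coeff_orderTop_ne h.orderTop_eq

/-- For `p_m` of valuation `e`, the largest `γ` at which the index `m` still has minimal weight
among the indices `j ≤ m`: minus the slope of the segment of the Newton polygon that ends at `m`. -/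
theorem exists_maximal_radius (hdiv : ∀ n : ℕ, n ≠ 0 → ∀ g : G, ∃ h : G, n • h = g)
    {p : ℝ⟦G⟧[X]} {m : ℕ} (hm : 0 < m) (h0 : p.coeff 0 ≠ 0) (e : G) :
    ∃ γ : G, (∀ j < m, ↑(e + (m - j) • γ) ≤ (p.coeff j).orderTop) ∧
      ∃ j < m, (p.coeff j).orderTop = ↑(e + (m - j) • γ) := by
  choose! d hd using fun (n : ℕ) (hn : n ≠ 0) => hdiv n hn
  classical
  let δ : ℕ → G := fun j => d (m - j) ((p.coeff j).order - e)
  have hδ : ∀ j < m, (p.coeff j).order = e + (m - j) • δ j := fun j hj => by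
    rw [hd (m - j) (by omega)]; abel
  obtain ⟨k, hk, hmin⟩ := ((Finset.range m).filter fun j => p.coeff j ≠ 0).exists_min_image δ
    ⟨0, by simp [hm, h0]⟩
  rw [Finset.mem_filter, Finset.mem_range] at hk
  refine ⟨δ k, fun j hj => ?_, k, hk.1, ?_⟩
  · by_cases hj0 : p.coeff j = 0
    · simp [hj0]
    rw [← order_eq_orderTop_of_ne_zero hj0, hδ j hj, WithTop.coe_le_coe]
    gcongr
    exact hmin j (by simp [hj, hj0])
  · rw [← order_eq_orderTop_of_ne_zero hk.2, hδ k hk.1]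

/-- A criterion for Newton degree `m` in terms of the valuation `e` of the coefficient `p_m`. -/
theorem isNewtonDegree_of_bounds {p : ℝ⟦G⟧[X]} {γ e : G} {m : ℕ} (hm : (p.coeff m).orderTop = ↑e)
    (hlo : ∀ j < m, ↑(e + (m - j) • γ) ≤ (p.coeff j).orderTop)
    (hhi : ∀ j, m < j → ↑(e - (j - m) • γ) < (p.coeff j).orderTop) :
    IsNewtonDegree p γ (e + m • γ) m := by
  have hexp : ∀ j, m < j → e + m • γ - j • γ = e - (j - m) • γ := by
    intro j hj
    obtain ⟨d, rfl⟩ := Nat.exists_eq_add_of_lt hj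
    rw [show m + d + 1 - m = d + 1 by omega, add_assoc m, add_nsmul _ m]; abel
  refine ⟨by rw [hm, add_sub_cancel_right], fun j => ?_, fun j hj => ?_⟩
  · rcases lt_trichotomy j m with hj | rfl | hj
    · convert hlo j hj using 2
      obtain ⟨d, rfl⟩ := Nat.exists_eq_add_of_le hj.le
      rw [Nat.add_sub_cancel_left, add_nsmul]; abel
    · rw [hm, add_sub_cancel_right]
    · rw [hexp j hj]
      exact (hhi j hj).le
  · rw [hexp j hj]
    exact hhi j hj

/-! ### Roots of odd Newton degree -/

/-- A ball on which `f` has odd Newton degree contains a smaller such ball, unless `f` has a root: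
move the centre to a root of odd multiplicity of the residue polynomial, then shrink the radius. -/
theorem IsNewtonDegree.exists_smaller (hdiv : ∀ n : ℕ, n ≠ 0 → ∀ g : G, ∃ h : G, n • h = g)
    {f : ℝ⟦G⟧[X]} (hf : ∀ x, ¬ f.IsRoot x) {a : ℝ⟦G⟧} {γ w : G} {m : ℕ} (hm : Odd m)
    (h : IsNewtonDegree (Polynomial.taylor a f) γ w m) :
    ∃ (a' : ℝ⟦G⟧) (γ' w' : G) (m' : ℕ), γ < γ' ∧ ↑γ ≤ (a' - a).orderTop ∧ Odd m' ∧
      IsNewtonDegree (Polynomial.taylor a' f) γ' w' m' := by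
  set p := Polynomial.taylor a f with hp
  have hρ : Odd (residuePoly p γ w).natDegree := h.natDegree_residuePoly.symm ▸ hm
  have hρ0 : residuePoly p γ w ≠ 0 := fun h0 => by simp [h0] at hρ
  obtain ⟨c, hc⟩ := Real.exists_odd_rootMultiplicity hρ
  set k := (residuePoly p γ w).rootMultiplicity c with hk
  set q := Polynomial.taylor (single γ c) p with hq
  have hqf : q = Polynomial.taylor (single γ c + a) f := by rw [hq, hp, taylor_taylor]
  have hqN : IsNewtonDegree q γ w m := h.taylor orderTop_single_le
  have hcoeff : ∀ j, (q.coeff j).coeff (w - j • γ) =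
      (Polynomial.taylor c (residuePoly p γ w)).coeff j := fun j => by
    rw [← residuePoly_taylor, coeff_residuePoly]
  -- so `k` is the first index of minimal weight for `q`
  have hke : (q.coeff k).orderTop = ↑(w - k • γ) := by
    refine le_antisymm (orderTop_le_of_coeff_ne_zero ?_) (hqN.le_orderTop k)
    rw [hcoeff]
    exact coeff_taylor_rootMultiplicity_ne_zero hρ0 c
  have hlt : ∀ j < k, ↑(w - j • γ) < (q.coeff j).orderTop := fun j hj =>
    lt_of_le_of_ne (hqN.le_orderTop j) (orderTop_ne_of_coeff_eq_zero (by
      rw [hcoeff]; exact coeff_taylor_of_lt_rootMultiplicity hj)).symm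
  have hq0 : q.coeff 0 ≠ 0 := by
    rw [hqf, taylor_coeff_zero]
    exact hf _
  obtain ⟨γ', hle, j, hj, hje⟩ := exists_maximal_radius hdiv hc.pos hq0 (w - k • γ)
  have hγ : γ < γ' := by
    have := hlt j hj
    obtain ⟨d, hd⟩ := Nat.exists_eq_add_of_le hj.le
    rw [hje, WithTop.coe_lt_coe, hd, Nat.add_sub_cancel_left] at this
    have h2 : d • γ < d • γ' := by
      rw [add_nsmul] at this
      have := add_lt_add_right this (j • γ + d • γ - w)
      convert this using 1 <;> abel
    exact lt_of_nsmul_lt_nsmul_right d h2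
  refine ⟨single γ c + a, γ', w - k • γ + k • γ', k, hγ, ?_, hc, ?_⟩
  · rw [add_sub_cancel_right]; exact orderTop_single_le
  · rw [← hqf]
    refine isNewtonDegree_of_bounds hke hle fun i hi => lt_of_lt_of_le ?_ (hqN.le_orderTop i)
    obtain ⟨d, rfl⟩ := Nat.exists_eq_add_of_lt hi
    rw [WithTop.coe_lt_coe, show k + d + 1 - k = d + 1 by omega, add_assoc k, add_nsmul _ k,
      ← sub_sub]
    gcongr

/-- If `f` has no root, a chain of balls on which `f` has odd Newton degree contains a further such
ball. By spherical completeness its members have a common point; from some member on the Newton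
degrees are constant, and the radius dictated by the Newton polygon at that point bounds the
chain. -/
theorem exists_isNewtonDegree_of_chain (hdiv : ∀ n : ℕ, n ≠ 0 → ∀ g : G, ∃ h : G, n • h = g)
    {f : ℝ⟦G⟧[X]} (hf : ∀ x, ¬ f.IsRoot x) {ι : Type*} [Nonempty ι] (a : ι → ℝ⟦G⟧) (γ w : ι → G)
    (m : ι → ℕ) (hm : ∀ i, Odd (m i))
    (h : ∀ i, IsNewtonDegree (Polynomial.taylor (a i) f) (γ i) (w i) (m i))
    (hchain : ∀ i j, γ i ≤ γ j → ↑(γ i) ≤ (a j - a i).orderTop) :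
    ∃ (b : ℝ⟦G⟧) (δ w' : G) (m' : ℕ), Odd m' ∧ IsNewtonDegree (Polynomial.taylor b f) δ w' m' ∧
      ∀ i, γ i ≤ δ ∧ ↑(γ i) ≤ (b - a i).orderTop := by
  obtain ⟨b, hb⟩ := exists_pseudoLimit a γ hchain
  set p := Polynomial.taylor b f with hp
  have hN : ∀ i, IsNewtonDegree p (γ i) (w i) (m i) := fun i => by
    have := (h i).taylor (hb i)
    rwa [taylor_taylor, sub_add_cancel] at this
  obtain ⟨i₀, hi₀⟩ : ∃ i₀, ∀ i, m i₀ ≤ m i :=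
    ⟨Function.argmin m, fun i => Function.argmin_le m i⟩
  have hconst : ∀ i, γ i₀ ≤ γ i → m i = m i₀ := fun i hi =>
    le_antisymm ((hN i₀).le_of_le (hN i) hi) (hi₀ i)
  have hp0 : p.coeff 0 ≠ 0 := by
    rw [hp, taylor_coeff_zero]
    exact hf b
  set n := m i₀ with hn
  obtain ⟨δ, hle, j, hj, hje⟩ := exists_maximal_radius hdiv (hm i₀).pos hp0 (w i₀ - n • γ i₀)
  have hbound : ∀ i, γ i₀ ≤ γ i → γ i ≤ δ := fun i hi => by
    have hNi := hN i
    rw [hconst i hi] at hNi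
    have hw : w i - n • γ i = w i₀ - n • γ i₀ :=
      WithTop.coe_injective (hNi.orderTop_eq.symm.trans (hN i₀).orderTop_eq)
    have h1 := hNi.le_orderTop j
    rw [hje, WithTop.coe_le_coe, ← hw] at h1
    obtain ⟨d, hd⟩ := Nat.exists_eq_add_of_le hj.le
    have hd0 : d ≠ 0 := by omega
    change n = j + d at hd
    rw [← hn, hd, Nat.add_sub_cancel_left, add_nsmul] at h1
    have h2 : d • γ i ≤ d • δ := by
      have := add_le_add_right h1 (j • γ i + d • γ i - w i)
      convert this using 1 <;> abel
    exact le_of_nsmul_le_nsmul_right hd0 h2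
  refine ⟨b, δ, _, n, hm i₀, isNewtonDegree_of_bounds (hN i₀).orderTop_eq hle fun i hi => ?_,
    fun i => ⟨?_, hb i⟩⟩
  · refine lt_of_le_of_lt ?_ ((hN i₀).lt_orderTop i hi)
    obtain ⟨d, rfl⟩ := Nat.exists_eq_add_of_le hi.le
    rw [WithTop.coe_le_coe, Nat.add_sub_cancel_left, add_nsmul, ← sub_sub]
    have := hbound i₀ le_rfl
    gcongr
  · rcases le_total (γ i₀) (γ i) with hi | hi
    · exact hbound i hi
    · exact hi.trans (hbound i₀ le_rfl)

/-- A polynomial with odd Newton degree on some ball has a root: by Zorn's lemma there would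
otherwise be a minimal such ball, which can be made smaller. -/
theorem IsNewtonDegree.exists_isRoot (hdiv : ∀ n : ℕ, n ≠ 0 → ∀ g : G, ∃ h : G, n • h = g)
    {f : ℝ⟦G⟧[X]} {a : ℝ⟦G⟧} {γ w : G} {m : ℕ} (hm : Odd m)
    (h : IsNewtonDegree (Polynomial.taylor a f) γ w m) : ∃ x, f.IsRoot x := by
  by_contra! hf
  -- balls with odd Newton degree, and reverse inclusion
  let B : Type _ := {x : ℝ⟦G⟧ × G //
    ∃ w m, Odd m ∧ IsNewtonDegree (Polynomial.taylor x.1 f) x.2 w m}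
  let r : B → B → Prop := fun x y => x.1.2 ≤ y.1.2 ∧ ↑x.1.2 ≤ (y.1.1 - x.1.1).orderTop
  obtain ⟨x, hx⟩ : ∃ x : B, ∀ y, r x y → r y x := by
    refine exists_maximal_of_chains_bounded (fun c hc => ?_) fun {x y z} hxy hyz => ?_
    · rcases c.eq_empty_or_nonempty with rfl | hne
      · exact ⟨⟨(a, γ), w, m, hm, h⟩, by simp⟩
      have := hne.to_subtype
      choose W M hM hW using fun i : c => i.1.2
      obtain ⟨b, δ, w', m', hm', hb, hub⟩ := exists_isNewtonDegree_of_chain hdiv hf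
        (fun i : c => i.1.1.1) (fun i : c => i.1.1.2) W M hM hW fun i j hij => by
          by_cases he : i = j
          · simp [he]
          rcases hc i.2 j.2 (fun h' => he (Subtype.ext h')) with h' | h'
          · exact h'.2
          · rw [← orderTop_neg, neg_sub]
            exact (WithTop.coe_le_coe.2 hij).trans h'.2
      exact ⟨⟨(b, δ), w', m', hm', hb⟩, fun y hy => hub ⟨y, hy⟩⟩
    · refine ⟨hxy.1.trans hyz.1, ?_⟩
      rw [← sub_add_sub_cancel]
      exact (le_min ((WithTop.coe_le_coe.2 hxy.1).trans hyz.2) hxy.2).trans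
        min_orderTop_le_orderTop_add
  obtain ⟨⟨b, δ⟩, w₁, m₁, hm₁, hb⟩ := x
  obtain ⟨a', γ', w', m', hlt, hle, hm', h'⟩ := hb.exists_smaller hdiv hf hm₁
  exact (hx ⟨(a', γ'), w', m', hm', h'⟩ ⟨hlt.le, hle⟩).1.not_gt hlt

theorem exists_isRoot_of_odd_natDegree (hdiv : ∀ n : ℕ, n ≠ 0 → ∀ g : G, ∃ h : G, n • h = g)
    {f : ℝ⟦G⟧[X]} (hf : Odd f.natDegree) : ∃ x, f.IsRoot x := by
  by_cases h0 : f.coeff 0 = 0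
  · exact ⟨0, by rw [IsRoot, ← coeff_zero_eq_eval_zero, h0]⟩
  have hlc : f.coeff f.natDegree ≠ 0 := by
    have : f ≠ 0 := by rintro rfl; simp at h0
    simpa using this
  -- all roots lie in a ball around `0`, on which the Newton degree is the degree
  obtain ⟨γ, hle, -⟩ := exists_maximal_radius hdiv hf.pos h0 (f.coeff f.natDegree).order
  have hN := isNewtonDegree_of_bounds (order_eq_orderTop_of_ne_zero hlc).symm hle fun j hj => by
    rw [coeff_eq_zero_of_natDegree_lt hj, orderTop_zero]
    exact WithTop.coe_lt_top _
  exact IsNewtonDegree.exists_isRoot (a := 0) hdiv hf (by rwa [taylor_zero])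

/-- A series `x` with leading term `r * t ^ (2k)`, `r > 0`, is a square: on a small ball around
`√r * t ^ k` the polynomial `X ^ 2 - x` has Newton degree one. -/
theorem isSquare_of_leadingCoeff_pos (hdiv : ∀ n : ℕ, n ≠ 0 → ∀ g : G, ∃ h : G, n • h = g)
    {x : ℝ⟦G⟧} (hx : 0 < x.leadingCoeff) : IsSquare x := by
  obtain ⟨k, hk⟩ := hdiv 2 two_ne_zero x.order
  have hx0 : x ≠ 0 := by rintro rfl; simp at hx
  have hr : √x.leadingCoeff ≠ 0 := (Real.sqrt_pos.2 hx).ne'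
  set a : ℝ⟦G⟧ := single k √x.leadingCoeff with ha
  have ha2 : a ^ 2 = single x.order x.leadingCoeff := by
    rw [ha, single_pow, hk, Real.sq_sqrt hx.le]
  by_cases hax : a ^ 2 - x = 0
  · exact ⟨a, by rw [← sq, sub_eq_zero.1 hax]⟩
  set γ := (a ^ 2 - x).order - k with hγ
  have hkγ : k < γ := by
    have h1 : ↑(2 • k) < (a ^ 2 - x).orderTop := by
      rw [hk]
      refine lt_of_le_of_ne ?_ (orderTop_ne_of_coeff_eq_zero ?_).symm
      · refine le_trans (le_min ?_ ?_) min_orderTop_le_orderTop_sub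
        · rw [ha2]; exact orderTop_single_le
        · exact (order_eq_orderTop_of_ne_zero hx0).le
      · rw [coeff_sub, ha2, coeff_single_same, leadingCoeff_eq, sub_self]
    rw [← order_eq_orderTop_of_ne_zero hax, WithTop.coe_lt_coe, two_nsmul] at h1
    exact lt_sub_iff_add_lt.2 h1
  obtain ⟨h0, h1, h2, h3⟩ := coeff_taylor_X_sq_sub_C a x
  have hN : IsNewtonDegree (Polynomial.taylor a (X ^ 2 - Polynomial.C x)) γ (k + 1 • γ) 1 := by
    refine isNewtonDegree_of_bounds ?_ (fun j hj => ?_) fun j hj => ?_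
    · rw [h1, ← single_zero_ofNat, ha, single_mul_single, zero_add,
        orderTop_single (mul_ne_zero two_ne_zero hr)]
    · obtain rfl : j = 0 := by omega
      rw [h0, ← order_eq_orderTop_of_ne_zero hax, Nat.sub_zero, one_nsmul, hγ, add_sub_cancel]
    · rcases eq_or_ne j 2 with rfl | hj2
      · rw [h2, orderTop_one, ← WithTop.coe_zero, WithTop.coe_lt_coe, show 2 - 1 = 1 from rfl,
          one_nsmul]
        exact sub_neg.2 hkγ
      · rw [h3 j (by omega), orderTop_zero]
        exact WithTop.coe_lt_top _
  obtain ⟨y, hy⟩ := hN.exists_isRoot hdiv odd_one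
  refine ⟨y, ?_⟩
  rw [IsRoot, eval_sub, eval_pow, eval_X, eval_C, sub_eq_zero] at hy
  rw [← hy, sq]

theorem isRealClosed_lex (hdiv : ∀ n : ℕ, n ≠ 0 → ∀ g : G, ∃ h : G, n • h = g) :
    IsRealClosed (Lex ℝ⟦G⟧) := by
  refine .of_linearOrderedField (fun {x} hx => ?_) fun {f} hf => ?_
  · rcases hx.eq_or_lt with rfl | hx
    · exact IsSquare.zero
    · exact isSquare_of_leadingCoeff_pos hdiv (leadingCoeff_pos_iff.2 hx)
  · exact exists_isRoot_of_odd_natDegree (G := G) hdiv (f := f) hf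

/-! ### The logarithm -/

theorem lt_of_orderTop_lt {Γ : Type*} [LinearOrder Γ] {x y : Lex ℝ⟦Γ⟧} (hx : 0 < x)
    (h : (ofLex x).orderTop < (ofLex y).orderTop) : y < x := by
  have := abs_lt_abs_of_orderTop_ofLex h
  rw [abs_of_pos hx] at this
  exact (le_abs_self y).trans_lt this

/-- A bound between series of comparable valuation: the leading coefficients are real numbers, so
the Archimedean property applies. -/
theorem exists_le_nsmul_of_orderTop_le {Γ : Type*} [LinearOrder Γ] {x y : Lex ℝ⟦Γ⟧} (hy : 0 < y)
    (h : (ofLex y).orderTop ≤ (ofLex x).orderTop) : ∃ n : ℕ, x ≤ n • y := by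
  have hy0 : (ofLex y).leadingCoeff ≠ 0 := leadingCoeff_ne_zero.2 hy.ne'
  have h1 : ArchimedeanClass.mk y ≤ ArchimedeanClass.mk x := by
    rw [archimedeanClassMk_le_archimedeanClassMk_iff]
    refine h.lt_or_eq.imp id fun h => ⟨h, ?_⟩
    obtain ⟨n, hn⟩ := Archimedean.arch |(ofLex x).leadingCoeff| (abs_pos.2 hy0)
    exact ArchimedeanClass.mk_le_mk.2 ⟨n, hn⟩
  obtain ⟨n, hn⟩ := ArchimedeanClass.mk_le_mk.1 h1
  exact ⟨n, (le_abs_self x).trans (by rwa [abs_of_pos hy] at hn)⟩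

theorem _root_.ArchimedeanClass.mk_le_mk_iff_of_pos {M : Type*} [AddCommGroup M] [LinearOrder M]
    [IsOrderedAddMonoid M] {a b : M} (ha : 0 < a) (hb : 0 < b) :
    ArchimedeanClass.mk a ≤ ArchimedeanClass.mk b ↔ ∃ n : ℕ, b ≤ n • a := by
  rw [ArchimedeanClass.mk_le_mk, abs_of_pos ha, abs_of_pos hb]

theorem _root_.FiniteArchimedeanClass.exists_pos_mk_eq {M : Type*} [AddCommGroup M] [LinearOrder M]
    [IsOrderedAddMonoid M] (c : FiniteArchimedeanClass M) :
    ∃ a : M, 0 < a ∧ ArchimedeanClass.mk a = c.1 := by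
  obtain ⟨a, ha⟩ := ArchimedeanClass.mk_surjective _ c.1
  refine ⟨|a|, abs_pos.2 ?_, by rw [ArchimedeanClass.mk_abs, ha]⟩
  rintro rfl
  exact c.2 (ha.symm.trans ArchimedeanClass.mk_zero)

/-- If `n (y - 1)` bounds `x - 1`, then `y ^ n` bounds `x`, by Bernoulli's inequality. The argument
is the same whether `y` is infinite, finite, or infinitely close to `1`. -/
theorem exists_le_pow_of_orderTop_le {x y : Lex ℝ⟦G⟧} (hy : 1 < y)
    (h : (ofLex (y - 1)).orderTop ≤ (ofLex (x - 1)).orderTop) : ∃ n : ℕ, x ≤ y ^ n := by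
  obtain ⟨n, hn⟩ := exists_le_nsmul_of_orderTop_le (sub_pos.2 hy) h
  have := one_add_mul_sub_le_pow (a := y) (by linarith) n
  rw [nsmul_eq_mul] at hn
  exact ⟨n, by linarith⟩

/-- Archimedean classes of the multiplicative group `K^{>0}`, which is written additively here, are
controlled by the valuation of `x - 1` on elements `x > 1`. Smaller classes are those of the larger
elements. -/
theorem archimedeanClassMk_le_of_orderTop_sub_one_le {x y : Additive {x : Lex ℝ⟦G⟧ // 0 < x}}
    (hx : 0 < x) (hy : 0 < y)
    (h : (ofLex (y.toMul.1 - 1)).orderTop ≤ (ofLex (x.toMul.1 - 1)).orderTop) :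
    ArchimedeanClass.mk y ≤ ArchimedeanClass.mk x := by
  obtain ⟨n, hn⟩ := exists_le_pow_of_orderTop_le (y := y.toMul.1) hy h
  exact (ArchimedeanClass.mk_le_mk_iff_of_pos hy hx).2 ⟨n, hn⟩

/-- An order embedding of the archimedean classes of `K^{>0}` into `G`: the class of `x > 1` goes to
the valuation of `x - 1`, for a chosen representative `x`. -/
theorem exists_archimedeanClass_orderEmbedding :
    ∃ φ : FiniteArchimedeanClass (Additive {x : Lex ℝ⟦G⟧ // 0 < x}) ↪o G,
      ∀ c, ∃ x : Additive {x : Lex ℝ⟦G⟧ // 0 < x}, 0 < x ∧ ArchimedeanClass.mk x = c.1 ∧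
        (ofLex (x.toMul.1 - 1)).orderTop = ↑(φ c) := by
  choose ρ hpos hmk using FiniteArchimedeanClass.exists_pos_mk_eq
    (M := Additive {x : Lex ℝ⟦G⟧ // 0 < x})
  have hne : ∀ c, ofLex ((ρ c).toMul.1 - 1) ≠ 0 := fun c =>
    (sub_pos.2 (show 1 < (ρ c).toMul.1 from hpos c)).ne'
  suffices hmono : StrictMono fun c => (ofLex ((ρ c).toMul.1 - 1)).order from
    ⟨OrderEmbedding.ofStrictMono _ hmono,
      fun c => ⟨ρ c, hpos c, hmk c, (order_eq_orderTop_of_ne_zero (hne c)).symm⟩⟩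
  intro c d hcd
  by_contra! h
  refine hcd.not_ge (show d.1 ≤ c.1 from ?_)
  rw [← hmk c, ← hmk d]
  refine archimedeanClassMk_le_of_orderTop_sub_one_le (hpos c) (hpos d) ?_
  rw [← order_eq_orderTop_of_ne_zero (hne c), ← order_eq_orderTop_of_ne_zero (hne d)]
  exact WithTop.coe_le_coe.2 h

/-- The embedding misses `g` or `2g` for every `g < 0`: representatives `x` and `y` with
`v (x - 1) = g` and `v (y - 1) = 2g` would lie in the same class. -/
theorem notMem_range_or_two_nsmul_notMem_range
    {φ : FiniteArchimedeanClass (Additive {x : Lex ℝ⟦G⟧ // 0 < x}) ↪o G}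
    (hφ : ∀ c, ∃ x : Additive {x : Lex ℝ⟦G⟧ // 0 < x}, 0 < x ∧ ArchimedeanClass.mk x = c.1 ∧
        (ofLex (x.toMul.1 - 1)).orderTop = ↑(φ c)) {g : G} (hg : g < 0) :
    g ∉ Set.range φ ∨ 2 • g ∉ Set.range φ := by
  by_contra! h
  obtain ⟨⟨c, hc⟩, d, hd⟩ := h
  obtain ⟨x, hx, hxc, hxv⟩ := hφ c
  obtain ⟨y, hy, hyd, hyv⟩ := hφ d
  rw [hc] at hxv
  rw [hd] at hyv
  have hx1 : 0 < x.toMul.1 - 1 := sub_pos.2 (show 1 < x.toMul.1 from hx)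
  have h2g : 2 • g < g := by rw [two_nsmul]; exact add_lt_of_neg_left g hg
  -- `y - 1` has valuation `2g`, while `(x - 1) ^ 3` has valuation `3g < 2g`
  have hyx : y.toMul.1 - 1 < (x.toMul.1 - 1) ^ 3 := by
    refine lt_of_orderTop_lt (pow_pos hx1 3) ?_
    rw [hyv, ofLex_pow, ← addVal_apply, AddValuation.map_pow, addVal_apply, hxv,
      ← WithTop.coe_nsmul, WithTop.coe_lt_coe, show 3 • g = 2 • g + g from succ_nsmul g 2]
    exact add_lt_of_neg_right _ hg
  have hyx' : y.toMul.1 ≤ x.toMul.1 ^ 3 := by nlinarith [mul_pos hx1 hx1]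
  have hle : ArchimedeanClass.mk x ≤ ArchimedeanClass.mk y := by
    exact (ArchimedeanClass.mk_le_mk_iff_of_pos hx hy).2 ⟨3, hyx'⟩
  have hge : ArchimedeanClass.mk y ≤ ArchimedeanClass.mk x := by
    refine archimedeanClassMk_le_of_orderTop_sub_one_le hx hy ?_
    rw [hxv, hyv]
    exact WithTop.coe_le_coe.2 h2g.le
  have hcd : c = d := Subtype.ext (by rw [← hxc, ← hyd]; exact le_antisymm hle hge)
  rw [hcd, hd] at hc
  exact h2g.ne hc

/-- The logarithm is the Hahn embedding of `K^{>0}`, with the exponents carried into `G`. -/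
theorem exists_isLogarithm_not_surjective [Nontrivial G] :
    ∃ f : {x : Lex ℝ⟦G⟧ // 0 < x} → Lex ℝ⟦G⟧, IsLogarithm f ∧ ¬ Function.Surjective f := by
  obtain ⟨F, hF, -⟩ := hahnEmbedding_isOrderedAddMonoid (Additive {x : Lex ℝ⟦G⟧ // 0 < x})
  obtain ⟨φ, hφ⟩ := exists_archimedeanClass_orderEmbedding (G := G)
  obtain ⟨g, hg⟩ : ∃ g, g ∉ Set.range φ := by
    obtain ⟨g, hg⟩ := exists_ne (0 : G)
    have hneg : -|g| < 0 := neg_lt_zero.2 (abs_pos.2 hg)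
    rcases notMem_range_or_two_nsmul_notMem_range hφ hneg with h | h
    · exact ⟨_, h⟩
    · exact ⟨_, h⟩
  let E := (embDomainOrderAddMonoidHom (R := ℝ) φ).comp F
  have hE : Function.Injective E :=
    (embDomainOrderAddMonoidHom_injective φ).comp hF
  refine ⟨fun x => E (Additive.ofMul x), ⟨fun x y => map_add E _ _, ?_⟩, fun hsurj => ?_⟩
  · exact ((OrderHomClass.mono E).strictMono_of_injective hE).comp fun _ _ h => h
  · -- the coefficients of `E x` vanish outside the range of `φ`
    obtain ⟨x, hx⟩ := hsurj (toLex (single g 1))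
    have h0 : (ofLex (E (Additive.ofMul x))).coeff g = 0 :=
      embDomain_of_notMem_range hg
    have hx' : E (Additive.ofMul x) = toLex (single g 1) := hx
    rw [hx', ofLex_toLex, coeff_single_same] at h0
    exact one_ne_zero h0

end HahnSeries

/-- `HahnSeries G ℝ` is the power series field `ℝ((G))`; `Lex` equips it with the order in which a
nonzero series is positive iff its coefficient at the least element of its support is positive. -/
theorem mainTheorem5 {G : Type*} [AddCommGroup G] [LinearOrder G] [IsOrderedAddMonoid G]
    [Nontrivial G]
    (hdiv : ∀ n : ℕ, n ≠ 0 → ∀ g : G, ∃ h : G, n • h = g) :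
    IsRealClosed (Lex (HahnSeries G ℝ)) ∧
      ∃ f : {x : Lex (HahnSeries G ℝ) // 0 < x} → Lex (HahnSeries G ℝ),
        IsLogarithm f ∧ ¬ Function.Surjective f :=
  ⟨isRealClosed_lex hdiv, exists_isLogarithm_not_surjective⟩
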